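/- Let $X\in\mathbb R^{n\times p}$ be a fixed (non-random) matrix, $\beta^0\in\mathbb R^p$, and $Y=X\beta^0+\epsilon$, where $\epsilon\in\mathbb R^n$ has i.i.d. standard Gaussian entries. Let $S_0=\{j:\beta^0_j\neq 0\}$ and $s_0=|S_0|$ (non-empty). For $S\subset\{1,\dots,p\}$ write $X_S$, $X_{-S}$ for the submatrices of columns with index in $S$, respectively outside $S$, and $b_S$, $b_{-S}$ for the corresponding subvectors of $b\in\mathbb R^p$. For a vector $w=(w_j)_{j\notin S_0}$ of non-negative weights let $W=\mathrm{diag}(w)$ and $$\hat\kappa^2(w,S_0)=\min\{s_0\|Xb\|_2^2/n:\ \|b_{S_0}\|_1-\|Wb_{-S_0}\|_1=1\}.$$ Put $X_{-S_0}\mathrm A X_{S_0}=X_{-S_0}-X_{S_0}(X_{S_0}^TX_{S_0})^{-1}X_{S_0}^TX_{-S_0}$, and for $j\notin S_0$ let $v_j\ge 0$ be such that $v_j^2$ is the $j$-th diagonal entry of $(X_{-S_0}\mathrm A X_{S_0})^T(X_{-S_0}\mathrm A X_{S_0})$. Let $d_j$, $j\in S_0$, be the diagonal entries of $(X_{S_0}^TX_{S_0})^{-1}$,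 and let $(u_j)_{j\in S_0}$ be either $(d_j)_{j\in S_0}$ or $(\sqrt{d_j})_{j\in S_0}$ (the result is claimed for each of the two choices). Let $t>0$ and $\lambda>\|v_{-S_0}\|_\infty\sqrt{2(\log(2p)+t)}$ (with $\|v_{-S_0}\|_\infty=0$ if $S_0=\{1,\dots,p\}$), and define $$\bar v_j=v_j\sqrt{2(\log(2p)+t)}/\lambda\ \ (j\notin S_0),\qquad \bar u_j=u_j\sqrt{2(\log(2p)+t)}/\lambda\ \ (j\in S_0).$$ Assume that $\hat\kappa^2(1+\bar v,S_0)>0$ (this implies that $X_{S_0}^TX_{S_0}$ is invertible). Let $b^*$ be any minimizer of $\|Xb\|_2^2$ subject to $\|b_{S_0}\|_1-\sum_{j\notin S_0}(1+\bar v_j)|b_j|=1$ and let $z_j^*=\mathrm{sign}(b_j^*)$ for $j\in S_0$. Let $\mathcal W=\{w\in\mathbb R^{p-s_0}: 1-\bar v_j\le w_j\le 1+\bar v_j\ \forall j\notin S_0\}$, and for each $w\in\mathcal W$ let $b(w)$ be any minimizer of $\|Xb\|_2^2$ subject to $\sum_{j\in S_0}z_j^*b_j-\|Wb_{-S_0}\|_1\ge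 1$. Put $$\mathbf b_j=\sup_{w\in\mathcal W}\frac{|b_j(w)|}{\|Xb(w)\|_2^2}\in[0,\infty],\qquad j\in S_0,$$ where $c/0=\infty$ for $c>0$ and $0/0=0$. Assume the betamin condition $$|\beta^0_j|>\lambda(\mathbf b_j+\bar u_j)\quad\text{and}\quad \mathrm{sign}(\beta^0_j)=z_j^*\qquad\text{for all } j\in S_0.$$ Then for every $x>0$, with probability at least $1-e^{-t}-e^{-x}$, there exists a solution $\hat\beta$ of the Lasso KKT conditions $$X^T(Y-X\hat\beta)=\lambda\hat\zeta,\qquad \|\hat\zeta\|_\infty\le 1,\quad \hat\zeta^T\hat\beta=\|\hat\beta\|_1,$$ such that $$\|X(\hat\beta-\beta^0)\|_2\ \ge\ \sqrt{\frac{s_0}{\hat\kappa^2(1+\bar v,S_0)}}\sqrt{\frac{\lambda^2}{n}}-\sqrt{s_0}-\sqrt{2x}.$$ -/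

import Mathlib

open MeasureTheory ProbabilityTheory
open scoped Matrix ENNReal

noncomputable section

namespace LassoLower

/-- Euclidean norm of a plain vector. -/
def l2norm {m : ℕ} (y : Fin m → ℝ) : ℝ := ‖WithLp.toLp 2 y‖

/-- `a` is a minimizer of `f` over the set `s`. -/
def IsArgmin {α : Type*} (f : α → ℝ) (s : Set α) (a : α) : Prop :=
  a ∈ s ∧ ∀ c ∈ s, f a ≤ f c

/-- The active set of a coefficient vector. -/
def activeSet {p : ℕ} (β : Fin p → ℝ) : Finset (Fin p) :=
  Finset.univ.filter fun j => β j ≠ 0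

/-- `‖W b_{-S}‖₁` with `W = diag w`. -/
def offNorm {p : ℕ} (S : Finset (Fin p)) (w : {j // j ∉ S} → ℝ) (b : Fin p → ℝ) : ℝ :=
  ∑ j : {j // j ∉ S}, |w j * b j|

/-- `{b : ‖b_S‖₁ - ‖W b_{-S}‖₁ = 1}`. -/
def compatSet {p : ℕ} (S : Finset (Fin p)) (w : {j // j ∉ S} → ℝ) : Set (Fin p → ℝ) :=
  {b | (∑ j ∈ S, |b j|) - offNorm S w b = 1}

/-- The squared empirical compatibility constant: the minimum of `|S| ‖X b‖₂² / n` over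
`compatSet S w`. (For nonempty `S` the minimum exists and is the infimum below.) -/
def compatSq {n p : ℕ} (X : Matrix (Fin n) (Fin p) ℝ) (S : Finset (Fin p))
    (w : {j // j ∉ S} → ℝ) : ℝ :=
  sInf ((fun b : Fin p → ℝ => (S.card : ℝ) * l2norm (X *ᵥ b) ^ 2 / n) '' compatSet S w)

/-- `{b : z_Sᵀ b_S - ‖W b_{-S}‖₁ ≥ 1}`. -/
def signedSet {p : ℕ} (S : Finset (Fin p)) (z : Fin p → ℝ) (w : {j // j ∉ S} → ℝ) :
    Set (Fin p → ℝ) :=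
  {b | 1 ≤ (∑ j ∈ S, z j * b j) - offNorm S w b}

/-- The weights `w` with `1 - v̄_j ≤ w_j ≤ 1 + v̄_j`. -/
def weights {p : ℕ} (S : Finset (Fin p)) (vbar : {j // j ∉ S} → ℝ) :
    Set ({j // j ∉ S} → ℝ) :=
  {w | ∀ j, 1 - vbar j ≤ w j ∧ w j ≤ 1 + vbar j}

/-- `max_{w ∈ 𝒲} |b_j(w)| / ‖X b(w)‖₂²`, in `[0, ∞]`, for a choice `w ↦ b(w)` of vectors.
With extended values a vanishing denominator makes the ratio infinite (if `b_j(w) ≠ 0`). -/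
def boldB {n p : ℕ} (X : Matrix (Fin n) (Fin p) ℝ) {S : Finset (Fin p)}
    (vbar : {j // j ∉ S} → ℝ) (b : ({j // j ∉ S} → ℝ) → Fin p → ℝ) (j : Fin p) : ℝ≥0∞ :=
  ⨆ w ∈ weights S vbar, ENNReal.ofReal |b w j| / ENNReal.ofReal (l2norm (X *ᵥ b w) ^ 2)

/-- The columns of `X` with index in `S`. -/
def colsIn {n p : ℕ} (X : Matrix (Fin n) (Fin p) ℝ) (S : Finset (Fin p)) :
    Matrix (Fin n) {j // j ∈ S} ℝ := X.submatrix id Subtype.val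

/-- The columns of `X` with index outside `S`. -/
def colsOut {n p : ℕ} (X : Matrix (Fin n) (Fin p) ℝ) (S : Finset (Fin p)) :
    Matrix (Fin n) {j // j ∉ S} ℝ := X.submatrix id Subtype.val

/-- `(X_Sᵀ X_S)⁻¹`. -/
def gramInv {n p : ℕ} (X : Matrix (Fin n) (Fin p) ℝ) (S : Finset (Fin p)) :
    Matrix {j // j ∈ S} {j // j ∈ S} ℝ := ((colsIn X S)ᵀ * colsIn X S)⁻¹

/-- The anti-projection `X_{-S} - X_S (X_Sᵀ X_S)⁻¹ X_Sᵀ X_{-S}`. -/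
def antiProj {n p : ℕ} (X : Matrix (Fin n) (Fin p) ℝ) (S : Finset (Fin p)) :
    Matrix (Fin n) {j // j ∉ S} ℝ :=
  colsOut X S - colsIn X S * gramInv X S * (colsIn X S)ᵀ * colsOut X S

/-- `v_j`, the nonnegative root of the `j`-th diagonal entry of the anti-projection Gram matrix. -/
def antiProjScale {n p : ℕ} (X : Matrix (Fin n) (Fin p) ℝ) (S : Finset (Fin p)) :
    {j // j ∉ S} → ℝ :=
  fun j => √(((antiProj X S)ᵀ * antiProj X S) j j)

/-- The noise level `√(2 (log (2p) + t))`. -/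
def noiseLevel (p : ℕ) (t : ℝ) : ℝ := √(2 * (Real.log (2 * p) + t))

/-- `v̄_j = v_j √(2 (log (2p) + t)) / λ`. -/
def vBar {n p : ℕ} (X : Matrix (Fin n) (Fin p) ℝ) (S : Finset (Fin p)) (lam t : ℝ) :
    {j // j ∉ S} → ℝ :=
  fun j => antiProjScale X S j * noiseLevel p t / lam

/-- The subdifferential of the `ℓ₁`-norm. -/
def subdiffL1 {p : ℕ} (b : Fin p → ℝ) : Set (Fin p → ℝ) :=
  {z | z ⬝ᵥ b = ∑ j, |b j| ∧ ∀ j, |z j| ≤ 1}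

/-- The KKT conditions of the Lasso `min_b ‖Y - X b‖₂² + 2 λ ‖b‖₁`. -/
def IsLassoKKT {n p : ℕ} (X : Matrix (Fin n) (Fin p) ℝ) (Y : Fin n → ℝ) (lam : ℝ)
    (b : Fin p → ℝ) : Prop :=
  ∃ ζ ∈ subdiffL1 b, Xᵀ *ᵥ (Y - X *ᵥ b) = lam • ζ

end LassoLower

end

/-!
The noise is split as `ε = π + r`, where `π` is its orthogonal projection onto the span of the
columns of `X` with index in `S₀`, so that `r` is orthogonal to these columns. The Lasso prediction
is a nonexpansive function of the response (`IsLassoKKT.l2norm_sub_le`), so passing from the noise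
`ε` to the noise `r` changes the prediction by at most `‖π‖₂`. As `π` is a standard Gaussian vector
in dimension at most `s₀`, a Chernoff bound gives `‖π‖₂ ≤ √s₀ + √(2x)` up to probability `e⁻ˣ`
(`stdGaussian_norm_starProjection_gt_le`).

For the noise `r`, the correlation of an inactive column with the noise is the inner product of `ε`
with the corresponding column of the anti-projection, a centred Gaussian variable of standard
deviation `v_j`. Up to probability `e⁻ᵗ`, all these correlations are at most `λ v̄_j`. The rest is
deterministic (`IsLassoKKT.le_of_orthogonal_noise`): the signs of the Lasso solution `β` outside
`S₀` turn the noise into weights `w` with `1 - v̄_j ≤ w_j ≤ 1 + v̄_j`. The rescaled minimizer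
`D = λ b(w) / ‖X b(w)‖₂²` satisfies the variational inequality
`⟨X D, X c⟩ ≥ λ (zᵀ c_S - ‖W c_{-S}‖₁)` for all `c`, and the betamin condition says that `β₀ - D` has
signs `z` on `S₀`. Monotonicity of the `ℓ₁`-subdifferential then gives `X (β₀ - β) = X D`, and the
test vector `c = b*` yields `λ ≤ ⟨X (β₀ - β), X b*⟩ ≤ ‖X (β₀ - β)‖₂ ‖X b*‖₂`, where `‖X b*‖₂²` is
`n / s₀` times the compatibility constant.
-/

namespace LassoLower

/-! ### Euclidean norm and dot product -/

lemma l2norm_nonneg {m : ℕ} (y : Fin m → ℝ) : 0 ≤ l2norm y := norm_nonneg _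

lemma l2norm_sq {m : ℕ} (y : Fin m → ℝ) : l2norm y ^ 2 = y ⬝ᵥ y := by
  rw [l2norm, EuclideanSpace.real_norm_sq_eq]
  simp [dotProduct, sq]

lemma dotProduct_le_l2norm_mul {m : ℕ} (x y : Fin m → ℝ) : x ⬝ᵥ y ≤ l2norm x * l2norm y := by
  have h := real_inner_le_norm (WithLp.toLp 2 x : EuclideanSpace ℝ (Fin m)) (WithLp.toLp 2 y)
  simpa [EuclideanSpace.inner_eq_star_dotProduct, dotProduct_comm, l2norm] using h

lemma l2norm_add_le {m : ℕ} (x y : Fin m → ℝ) : l2norm (x + y) ≤ l2norm x + l2norm y := by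
  simpa [l2norm] using norm_add_le (WithLp.toLp 2 x : EuclideanSpace ℝ (Fin m)) (WithLp.toLp 2 y)

lemma l2norm_neg {m : ℕ} (x : Fin m → ℝ) : l2norm (-x) = l2norm x := by
  simp [l2norm]

lemma continuous_l2norm {m : ℕ} : Continuous (l2norm : (Fin m → ℝ) → ℝ) := by
  unfold l2norm
  fun_prop

lemma mulVec_dotProduct_mulVec {n p : ℕ} (X : Matrix (Fin n) (Fin p) ℝ) (y : Fin n → ℝ)
    (c : Fin p → ℝ) : (Xᵀ *ᵥ y) ⬝ᵥ c = y ⬝ᵥ (X *ᵥ c) := by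
  rw [Matrix.dotProduct_mulVec, Matrix.mulVec_transpose]

/-- First-order condition: a quadratic that is nonnegative on `(0, 1]` and vanishes at `0` has a
nonnegative derivative at `0`. -/
lemma nonneg_of_forall_quadratic_nonneg {d q : ℝ}
    (h : ∀ s : ℝ, 0 < s → s ≤ 1 → 0 ≤ s * d + s ^ 2 * q) : 0 ≤ d := by
  by_contra! hd
  have hq : 0 < |q| + 1 := by positivity
  have hs : 0 < min 1 (-d / (|q| + 1)) := lt_min one_pos (div_pos (by linarith) hq)
  have h1 := h _ hs (min_le_left _ _)
  set s := min 1 (-d / (|q| + 1)) with hsdef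
  have h2 : s * (|q| + 1) ≤ -d := by
    rw [← le_div_iff₀ hq]; exact min_le_right _ _
  have h3 : s * q ≤ s * |q| := mul_le_mul_of_nonneg_left (le_abs_self q) hs.le
  have h4 : 0 ≤ d + s * q := by
    by_contra! h5
    nlinarith [mul_pos_of_neg_of_neg h5 (neg_neg_of_pos hs)]
  linarith

lemma sum_eq_sum_mem_add_sum_notMem {p : ℕ} (S : Finset (Fin p)) (f : Fin p → ℝ) :
    ∑ j, f j = ∑ j ∈ S, f j + ∑ j : {j // j ∉ S}, f j := by
  rw [← Fintype.sum_subtype_add_sum_subtype (fun j => j ∈ S) f]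
  congr 1
  exact (Finset.sum_subtype S (fun _ => Iff.rfl) f).symm

lemma mul_le_abs_of_abs_le_one {a c : ℝ} (h : |a| ≤ 1) : a * c ≤ |c| := by
  calc a * c ≤ |a| * |c| := by rw [← abs_mul]; exact le_abs_self _
    _ ≤ 1 * |c| := mul_le_mul_of_nonneg_right h (abs_nonneg _)
    _ = |c| := one_mul _

lemma sign_mul_self_eq_abs (a : ℝ) : Real.sign a * a = |a| := by
  rcases lt_trichotomy a 0 with h | h | h
  · rw [Real.sign_of_neg h, abs_of_neg h, neg_one_mul]
  · simp [h]
  · rw [Real.sign_of_pos h, abs_of_pos h, one_mul]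

/-! ### The Lasso: existence, KKT conditions, nonexpansiveness -/

/-- The Lasso has a solution, since its objective is continuous and coercive. -/
lemma exists_isMin_lasso {n p : ℕ} (X : Matrix (Fin n) (Fin p) ℝ) (Y : Fin n → ℝ) {lam : ℝ}
    (hlam : 0 < lam) :
    ∃ b : Fin p → ℝ, ∀ c : Fin p → ℝ,
      l2norm (Y - X *ᵥ b) ^ 2 + 2 * lam * ∑ j, |b j| ≤
        l2norm (Y - X *ᵥ c) ^ 2 + 2 * lam * ∑ j, |c j| := by
  refine Continuous.exists_forall_le
    (f := fun b : Fin p → ℝ => l2norm (Y - X *ᵥ b) ^ 2 + 2 * lam * ∑ j, |b j|) ?_ ?_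
  · have : Continuous fun b : Fin p → ℝ => l2norm (Y - X *ᵥ b) :=
      continuous_l2norm.comp (continuous_const.sub (Continuous.matrix_mulVec continuous_const
        continuous_id))
    fun_prop
  · refine Filter.tendsto_atTop_mono (f := fun b : Fin p → ℝ => 2 * lam * ‖b‖) (fun b => ?_) ?_
    · have h : ‖b‖ ≤ ∑ j, |b j| := by
        rw [pi_norm_le_iff_of_nonneg (Finset.sum_nonneg fun j _ => abs_nonneg _)]
        intro j
        exact Finset.single_le_sum (f := fun j => |b j|) (fun j _ => abs_nonneg _)
          (Finset.mem_univ j)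
      have := mul_le_mul_of_nonneg_left h (by positivity : 0 ≤ 2 * lam)
      have := sq_nonneg (l2norm (Y - X *ᵥ b))
      linarith
    · exact (tendsto_norm_cocompact_atTop (E := Fin p → ℝ)).const_mul_atTop (by positivity)

/-- Existence of a solution of the KKT conditions of the Lasso. The subgradient is read off the
variational inequality by testing with `0`, with twice the solution, and with its translates along
the coordinate axes. -/
lemma exists_isLassoKKT {n p : ℕ} (X : Matrix (Fin n) (Fin p) ℝ) (Y : Fin n → ℝ) {lam : ℝ}
    (hlam : 0 < lam) : ∃ b, IsLassoKKT X Y lam b := by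
  obtain ⟨b, hb⟩ := exists_isMin_lasso X Y hlam
  set g : Fin p → ℝ := Xᵀ *ᵥ (Y - X *ᵥ b) with hg
  have key : ∀ d : Fin p → ℝ, g ⬝ᵥ d ≤ lam * (∑ j, |b j + d j| - ∑ j, |b j|) := by
    intro d
    have h := nonneg_of_forall_quadratic_nonneg
      (d := 2 * lam * (∑ j, |b j + d j| - ∑ j, |b j|) - 2 * (g ⬝ᵥ d))
      (q := (X *ᵥ d) ⬝ᵥ (X *ᵥ d)) ?_
    · linarith
    intro s hs hs1
    have h1 := hb (b + s • d)
    have h2 : ∑ j, |(b + s • d) j| ≤ (1 - s) * ∑ j, |b j| + s * ∑ j, |b j + d j| := by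
      rw [Finset.mul_sum, Finset.mul_sum, ← Finset.sum_add_distrib]
      refine Finset.sum_le_sum fun j _ => ?_
      have e : (b + s • d) j = (1 - s) * b j + s * (b j + d j) := by
        simp only [Pi.add_apply, Pi.smul_apply, smul_eq_mul]; ring
      rw [e]
      refine (abs_add_le _ _).trans ?_
      rw [abs_mul, abs_mul, abs_of_pos hs, abs_of_nonneg (by linarith : 0 ≤ 1 - s)]
    have h3 : Y - X *ᵥ (b + s • d) = (Y - X *ᵥ b) - s • (X *ᵥ d) := by
      rw [Matrix.mulVec_add, Matrix.mulVec_smul]; abel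
    rw [h3, l2norm_sq, l2norm_sq] at h1
    have h4 : g ⬝ᵥ d = (Y - X *ᵥ b) ⬝ᵥ (X *ᵥ d) := mulVec_dotProduct_mulVec _ _ _
    have h5 : (X *ᵥ d) ⬝ᵥ (Y - X *ᵥ b) = g ⬝ᵥ d := by rw [h4, dotProduct_comm]
    simp only [sub_dotProduct _ (s • (X *ᵥ d)), dotProduct_sub _ _ (s • (X *ᵥ d)), dotProduct_smul,
      smul_dotProduct, smul_eq_mul, h5, ← h4] at h1
    have h6 := mul_le_mul_of_nonneg_left h2 (by positivity : 0 ≤ 2 * lam)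
    nlinarith
  refine ⟨b, lam⁻¹ • g, ⟨?_, fun j => ?_⟩, ?_⟩
  · rw [smul_dotProduct, smul_eq_mul]
    have h1 := key b
    have h2 := key (-b)
    have e : ∑ j, |b j + b j| = 2 * ∑ j, |b j| := by
      rw [Finset.mul_sum]
      refine Finset.sum_congr rfl fun j _ => ?_
      rw [← two_mul, abs_mul, abs_two]
    simp only [Pi.neg_apply, add_neg_cancel, abs_zero, Finset.sum_const_zero, dotProduct_neg] at h2
    rw [e] at h1
    rw [inv_mul_eq_iff_eq_mul₀ hlam.ne']
    linarith
  · have aux : ∀ c : ℝ, g j * c ≤ lam * |c| := by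
      intro c
      have h := key (Pi.single j c)
      rw [dotProduct_single] at h
      refine h.trans (mul_le_mul_of_nonneg_left ?_ hlam.le)
      rw [← Finset.sum_sub_distrib]
      calc ∑ i, (|b i + (Pi.single j c : Fin p → ℝ) i| - |b i|)
          ≤ ∑ i, |(Pi.single j c : Fin p → ℝ) i| :=
            Finset.sum_le_sum fun i _ => by
              have := abs_add_le (b i) ((Pi.single j c : Fin p → ℝ) i); linarith
        _ = |c| := by
            rw [Finset.sum_eq_single j]
            · simp
            · intro i _ hi; simp [hi]
            · simp
    have h1 := aux 1
    have h2 := aux (-1)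
    simp only [abs_one, abs_neg] at h1 h2
    rw [Pi.smul_apply, smul_eq_mul, abs_le, inv_mul_eq_div, le_div_iff₀ hlam, div_le_iff₀ hlam]
    constructor <;> linarith
  · rw [smul_smul, mul_inv_cancel₀ hlam.ne', one_smul]

lemma dotProduct_le_of_mem_subdiffL1 {p : ℕ} {b ζ : Fin p → ℝ} (h : ζ ∈ subdiffL1 b)
    (c : Fin p → ℝ) : ζ ⬝ᵥ c ≤ ∑ j, |c j| := by
  exact Finset.sum_le_sum fun j _ => mul_le_abs_of_abs_le_one (h.2 j)

lemma mul_eq_abs_of_mem_subdiffL1 {p : ℕ} {b ζ : Fin p → ℝ} (h : ζ ∈ subdiffL1 b) (j : Fin p) :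
    ζ j * b j = |b j| :=
  (Finset.sum_eq_sum_iff_of_le fun i _ => mul_le_abs_of_abs_le_one (h.2 i)).1 h.1 j
    (Finset.mem_univ j)

/-- The Lasso prediction is a nonexpansive function of the response, by monotonicity of the
subdifferential of the `ℓ₁`-norm. -/
lemma IsLassoKKT.l2norm_sub_le {n p : ℕ} {X : Matrix (Fin n) (Fin p) ℝ} {Y Y' : Fin n → ℝ}
    {lam : ℝ} (hlam : 0 ≤ lam) {b b' : Fin p → ℝ} (h : IsLassoKKT X Y lam b)
    (h' : IsLassoKKT X Y' lam b') : l2norm (X *ᵥ (b - b')) ≤ l2norm (Y - Y') := by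
  obtain ⟨ζ, hζ, e⟩ := h
  obtain ⟨ζ', hζ', e'⟩ := h'
  have h1 : 0 ≤ (ζ - ζ') ⬝ᵥ (b - b') := by
    have h1 := dotProduct_le_of_mem_subdiffL1 hζ b'
    have h2 := dotProduct_le_of_mem_subdiffL1 hζ' b
    rw [sub_dotProduct, dotProduct_sub, dotProduct_sub, hζ.1, hζ'.1]
    linarith
  have h2 : (Y - Y' - X *ᵥ (b - b')) ⬝ᵥ (X *ᵥ (b - b')) = lam * ((ζ - ζ') ⬝ᵥ (b - b')) := by
    rw [← mulVec_dotProduct_mulVec, ← smul_eq_mul, ← smul_dotProduct, smul_sub, ← e, ← e',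
      ← Matrix.mulVec_sub, Matrix.mulVec_sub X]
    congr 2
    abel
  have h3 := mul_nonneg hlam h1
  rw [← h2, sub_dotProduct, ← l2norm_sq] at h3
  have h4 := dotProduct_le_l2norm_mul (Y - Y') (X *ᵥ (b - b'))
  by_contra! h5
  have h6 := l2norm_nonneg (Y - Y')
  nlinarith

/-! ### Least-norm vectors under a sign-constrained compatibility condition -/

/-- The functional `z_Sᵀ b_S - ‖W b_{-S}‖₁`, whose superlevel set at `1` is `signedSet S z w`. -/
noncomputable def signedGain {p : ℕ} (S : Finset (Fin p)) (z : Fin p → ℝ)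
    (w : {j // j ∉ S} → ℝ) (b : Fin p → ℝ) : ℝ :=
  (∑ j ∈ S, z j * b j) - offNorm S w b

lemma signedGain_add_le {p : ℕ} (S : Finset (Fin p)) (z : Fin p → ℝ) (w : {j // j ∉ S} → ℝ)
    (b c : Fin p → ℝ) :
    signedGain S z w b + signedGain S z w c ≤ signedGain S z w (b + c) := by
  have h : offNorm S w (b + c) ≤ offNorm S w b + offNorm S w c := by
    unfold offNorm
    rw [← Finset.sum_add_distrib]
    refine Finset.sum_le_sum fun j _ => ?_
    rw [Pi.add_apply, mul_add]
    exact abs_add_le _ _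
  simp only [signedGain, Pi.add_apply, mul_add, Finset.sum_add_distrib]
  linarith

lemma signedGain_smul {p : ℕ} (S : Finset (Fin p)) (z : Fin p → ℝ) (w : {j // j ∉ S} → ℝ)
    (b : Fin p → ℝ) {a : ℝ} (ha : 0 ≤ a) :
    signedGain S z w (a • b) = a * signedGain S z w b := by
  simp only [signedGain, offNorm, Pi.smul_apply, smul_eq_mul, mul_sub, Finset.mul_sum]
  congr 1
  · exact Finset.sum_congr rfl fun j _ => by ring
  · exact Finset.sum_congr rfl fun j _ => by rw [mul_left_comm, abs_mul, abs_of_nonneg ha]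

/-- The variational inequality of a least-norm vector in `signedSet S z w`. It holds for every
test vector `c`, also where the gain of `c` is not positive, since the gain is concave and
positively homogeneous. -/
lemma mul_signedGain_le_of_isArgmin {n p : ℕ} {X : Matrix (Fin n) (Fin p) ℝ} {S : Finset (Fin p)}
    {z : Fin p → ℝ} {w : {j // j ∉ S} → ℝ} {b : Fin p → ℝ}
    (hb : IsArgmin (fun c => l2norm (X *ᵥ c) ^ 2) (signedSet S z w) b) (c : Fin p → ℝ) :
    l2norm (X *ᵥ b) ^ 2 * signedGain S z w c ≤ (X *ᵥ b) ⬝ᵥ (X *ᵥ c) := by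
  have hb1 : 1 ≤ signedGain S z w b := hb.1
  have h1 : ∀ c, 1 ≤ signedGain S z w c → l2norm (X *ᵥ b) ^ 2 ≤ (X *ᵥ b) ⬝ᵥ (X *ᵥ c) := by
    intro c hc
    have h := nonneg_of_forall_quadratic_nonneg (d := 2 * ((X *ᵥ b) ⬝ᵥ (X *ᵥ (c - b))))
      (q := (X *ᵥ (c - b)) ⬝ᵥ (X *ᵥ (c - b))) ?_
    · rw [Matrix.mulVec_sub, dotProduct_sub, ← l2norm_sq] at h
      linarith
    intro s hs hs1
    have hmem : (1 - s) • b + s • c ∈ signedSet S z w := by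
      have h2 := signedGain_add_le S z w ((1 - s) • b) (s • c)
      rw [signedGain_smul S z w b (by linarith), signedGain_smul S z w c hs.le] at h2
      change 1 ≤ signedGain S z w _
      nlinarith
    have h2 := hb.2 _ hmem
    have e : X *ᵥ ((1 - s) • b + s • c) = X *ᵥ b + s • (X *ᵥ (c - b)) := by
      rw [← Matrix.mulVec_smul, ← Matrix.mulVec_add]
      congr 1
      module
    simp only [e, l2norm_sq] at h2
    simp only [add_dotProduct, dotProduct_add, dotProduct_smul, smul_dotProduct, smul_eq_mul,
      dotProduct_comm (X *ᵥ (c - b)) (X *ᵥ b)] at h2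
    nlinarith
  have h2 : ∀ c, 0 < signedGain S z w c →
      l2norm (X *ᵥ b) ^ 2 * signedGain S z w c ≤ (X *ᵥ b) ⬝ᵥ (X *ᵥ c) := by
    intro c hc
    have h3 := h1 ((signedGain S z w c)⁻¹ • c) (by
      rw [signedGain_smul S z w c (by positivity), inv_mul_cancel₀ hc.ne'])
    rw [Matrix.mulVec_smul, dotProduct_smul, smul_eq_mul, inv_mul_eq_div, le_div_iff₀ hc] at h3
    exact h3
  -- adding a large multiple of `b` makes the gain of the test vector positive
  set M := |signedGain S z w c| + 1 with hM
  have hM0 : 0 ≤ M := by positivity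
  have h3 := signedGain_add_le S z w c (M • b)
  rw [signedGain_smul S z w b hM0] at h3
  have h4 : signedGain S z w c + M ≤ signedGain S z w (c + M • b) := by nlinarith
  have h5 : 0 < signedGain S z w c + M := by
    have := neg_abs_le (signedGain S z w c); linarith
  have h6 := h2 (c + M • b) (h5.trans_le h4)
  rw [Matrix.mulVec_add, Matrix.mulVec_smul, dotProduct_add, dotProduct_smul, smul_eq_mul,
    ← l2norm_sq] at h6
  nlinarith [mul_le_mul_of_nonneg_left h4 (sq_nonneg (l2norm (X *ᵥ b)))]

/-- Weights absorbing a linear perturbation `f` of the `ℓ₁`-subgradient `ζ` at `β`: the shifted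
subgradient `f - ζ` is a subgradient of the weighted norm at `-β`. -/
lemma exists_weight {v f ζ β : ℝ} (hf : |f| ≤ v) (hv : v < 1) (hζ : |ζ| ≤ 1)
    (hβ : ζ * β = |β|) :
    ∃ w, (1 - v ≤ w ∧ w ≤ 1 + v) ∧ |f - ζ| ≤ w ∧ (f - ζ) * -β = w * |β| := by
  obtain ⟨hf1, hf2⟩ := abs_le.1 hf
  obtain ⟨hζ1, hζ2⟩ := abs_le.1 hζ
  rcases lt_trichotomy β 0 with h | h | h
  · have : ζ = -1 := by
      rw [abs_of_neg h, neg_eq_neg_one_mul] at hβ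
      exact mul_right_cancel₀ h.ne hβ
    subst this
    refine ⟨1 + f, ⟨by linarith, by linarith⟩, ?_, ?_⟩
    · rw [abs_of_nonneg (by linarith)]; linarith
    · rw [abs_of_neg h]; ring
  · subst h
    refine ⟨1 + v, ⟨by linarith [abs_nonneg f], le_rfl⟩, ?_, by simp⟩
    rw [abs_le]; constructor <;> linarith
  · have : ζ = 1 := by
      rw [abs_of_pos h] at hβ
      exact mul_right_cancel₀ h.ne' (by rw [hβ, one_mul])
    subst this
    refine ⟨1 - f, ⟨by linarith, by linarith⟩, ?_, ?_⟩
    · rw [abs_of_nonpos (by linarith)]; linarith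
    · rw [abs_of_pos h]; ring

/-- Prediction error of the Lasso when the noise `r` is orthogonal to the active columns and its
correlation with the other columns is at most `λ v̄_j`. The proof freezes the signs of the Lasso
solution outside `S` into weights `w`. Rescaled by `λ / ‖X b(w)‖₂²`, the minimizer `b(w)` solves the
same variational problem as the Lasso error `β₀ - β`, because the betamin condition fixes the signs
on `S`; so the two have the same image under `X`, and testing with `bstar` gives the bound. -/
lemma IsLassoKKT.le_of_orthogonal_noise {n p : ℕ} {X : Matrix (Fin n) (Fin p) ℝ}
    {β₀ : Fin p → ℝ} {S : Finset (Fin p)} (hS : ∀ j ∉ S, β₀ j = 0) {lam : ℝ} (hlam : 0 < lam)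
    {vbar : {j // j ∉ S} → ℝ} (hv : ∀ j, vbar j < 1)
    {bstar : Fin p → ℝ} (hbstar : bstar ∈ compatSet S (fun j => 1 + vbar j))
    {b : ({j // j ∉ S} → ℝ) → Fin p → ℝ}
    (hb : ∀ w ∈ weights S vbar, IsArgmin (fun c => l2norm (X *ᵥ c) ^ 2)
        (signedSet S (fun j => Real.sign (bstar j)) w) (b w))
    (hpos : ∀ w ∈ weights S vbar, 0 < l2norm (X *ᵥ b w) ^ 2)
    (hbeta : ∀ w ∈ weights S vbar, ∀ j ∈ S, lam * |b w j| / l2norm (X *ᵥ b w) ^ 2 < |β₀ j|)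
    (hsign : ∀ j ∈ S, Real.sign (β₀ j) = Real.sign (bstar j))
    {r : Fin n → ℝ} (hrS : ∀ j ∈ S, (Xᵀ *ᵥ r) j = 0)
    (hr : ∀ j : {j // j ∉ S}, |(Xᵀ *ᵥ r) j| ≤ lam * vbar j)
    {β : Fin p → ℝ} (hβ : IsLassoKKT X (X *ᵥ β₀ + r) lam β) :
    lam ≤ l2norm (X *ᵥ bstar) * l2norm (X *ᵥ (β - β₀)) := by
  obtain ⟨ζ, hζ, e⟩ := hβ
  set z : Fin p → ℝ := fun j => Real.sign (bstar j) with hz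
  set f : {j // j ∉ S} → ℝ := fun j => (Xᵀ *ᵥ r) j / lam with hf
  have hw : ∀ j : {j // j ∉ S}, ∃ w, (1 - vbar j ≤ w ∧ w ≤ 1 + vbar j) ∧ |f j - ζ j| ≤ w ∧
      (f j - ζ j) * -β j = w * |β j| := fun j => by
    refine exists_weight ?_ (hv j) (hζ.2 j) (mul_eq_abs_of_mem_subdiffL1 hζ j)
    rw [hf, abs_div, abs_of_pos hlam, div_le_iff₀ hlam, mul_comm]
    exact hr j
  choose w hw1 hw2 hw3 using hw
  have hwW : w ∈ weights S vbar := hw1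
  have hw0 : ∀ j, 0 ≤ w j := fun j => (abs_nonneg _).trans (hw2 j)
  set m := l2norm (X *ᵥ b w) ^ 2 with hm
  have hm0 : 0 < m := hpos w hwW
  set D := β₀ - β with hD
  set Dw := (lam / m) • b w with hDw
  have hDoff : ∀ j : {j // j ∉ S}, D j = -β j := fun j => by
    simp [hD, hS j j.2]
  -- the stationarity condition of the Lasso, tested with `c`
  have hDc : ∀ c, (X *ᵥ D) ⬝ᵥ (X *ᵥ c) =
      lam * (∑ j ∈ S, ζ j * c j - ∑ j : {j // j ∉ S}, (f j - ζ j) * c j) := by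
    intro c
    have h1 : Xᵀ *ᵥ (X *ᵥ D) = lam • ζ - Xᵀ *ᵥ r := by
      rw [← e, hD, ← Matrix.mulVec_sub]
      congr 1
      rw [Matrix.mulVec_sub]
      abel
    rw [← mulVec_dotProduct_mulVec, h1, dotProduct,
      sum_eq_sum_mem_add_sum_notMem S, mul_sub, Finset.mul_sum, Finset.mul_sum,
      sub_eq_add_neg (∑ j ∈ S, _), ← Finset.sum_neg_distrib]
    congr 1
    · refine Finset.sum_congr rfl fun j hj => ?_
      simp only [Pi.sub_apply, Pi.smul_apply, smul_eq_mul, hrS j hj]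
      ring
    · refine Finset.sum_congr rfl fun j _ => ?_
      simp only [Pi.sub_apply, Pi.smul_apply, smul_eq_mul, hf]
      field_simp
      ring
  have hoff : ∀ c, offNorm S w c = ∑ j : {j // j ∉ S}, w j * |c j| := fun c =>
    Finset.sum_congr rfl fun j _ => by rw [abs_mul, abs_of_nonneg (hw0 j)]
  have hDD : (X *ᵥ D) ⬝ᵥ (X *ᵥ D) = lam * (∑ j ∈ S, ζ j * D j - offNorm S w D) := by
    rw [hDc, hoff]
    congr 2
    refine Finset.sum_congr rfl fun j _ => ?_
    rw [hDoff, hw3, abs_neg]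
  have hDDw : lam * (∑ j ∈ S, ζ j * Dw j - offNorm S w Dw) ≤ (X *ᵥ D) ⬝ᵥ (X *ᵥ Dw) := by
    rw [hDc, hoff]
    refine mul_le_mul_of_nonneg_left (sub_le_sub_left (Finset.sum_le_sum fun j _ => ?_) _) hlam.le
    calc (f j - ζ j) * Dw j ≤ |f j - ζ j| * |Dw j| := by rw [← abs_mul]; exact le_abs_self _
      _ ≤ w j * |Dw j| := mul_le_mul_of_nonneg_right (hw2 j) (abs_nonneg _)
  have hDwc : ∀ c, lam * signedGain S z w c ≤ (X *ᵥ Dw) ⬝ᵥ (X *ᵥ c) := by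
    intro c
    have h1 := mul_signedGain_le_of_isArgmin (hb w hwW) c
    rw [hDw, Matrix.mulVec_smul, smul_dotProduct, smul_eq_mul]
    have h2 := mul_le_mul_of_nonneg_left h1 (div_pos hlam hm0).le
    rwa [← mul_assoc, div_mul_cancel₀ _ hm0.ne'] at h2
  have hDwDw : (X *ᵥ Dw) ⬝ᵥ (X *ᵥ Dw) ≤ lam * signedGain S z w Dw := by
    have hb1 : 1 ≤ signedGain S z w (b w) := (hb w hwW).1
    rw [hDw, signedGain_smul S z w _ (div_pos hlam hm0).le, Matrix.mulVec_smul, smul_dotProduct,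
      dotProduct_smul, ← l2norm_sq, ← hm, smul_eq_mul, smul_eq_mul, div_mul_cancel₀ _ hm0.ne']
    have := div_pos hlam hm0
    nlinarith [mul_pos this hlam]
  -- `z` is the sign vector on `S` both of `β₀` and of `β₀ - Dw`
  have hmono : ∑ j ∈ S, (ζ j - z j) * (D j - Dw j) ≤ 0 := by
    refine Finset.sum_nonpos fun j hj => ?_
    have hlt : |Dw j| < |β₀ j| := by
      refine lt_of_eq_of_lt ?_ (hbeta w hwW j hj)
      rw [hDw, Pi.smul_apply, smul_eq_mul, abs_mul, abs_of_pos (div_pos hlam hm0),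
        div_mul_eq_mul_div]
    have h1 : z j * (β₀ j - Dw j) = |β₀ j - Dw j| ∧ |z j| ≤ 1 := by
      rw [hz]
      simp only
      rw [← hsign j hj]
      rcases lt_trichotomy (β₀ j) 0 with h | h | h
      · rw [abs_of_neg h, abs_lt] at hlt
        rw [Real.sign_of_neg h, abs_of_neg (by linarith)]
        norm_num
      · simp [h] at hlt
        exact absurd hlt (not_lt.2 (abs_nonneg _))
      · rw [abs_of_pos h, abs_lt] at hlt
        rw [Real.sign_of_pos h, abs_of_pos (by linarith)]
        norm_num
    have h2 := mul_eq_abs_of_mem_subdiffL1 hζ j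
    have h3 : ζ j * (β₀ j - Dw j) ≤ |β₀ j - Dw j| := mul_le_abs_of_abs_le_one (hζ.2 j)
    have h4 : z j * β j ≤ |β j| := mul_le_abs_of_abs_le_one h1.2
    have h5 := h1.1
    have e1 : (ζ j - z j) * (D j - Dw j) =
        ζ j * (β₀ j - Dw j) - ζ j * β j - (z j * (β₀ j - Dw j) - z j * β j) := by
      rw [hD, Pi.sub_apply]; ring
    rw [e1]
    linarith
  have hXD : X *ᵥ (D - Dw) = 0 := by
    rw [← dotProduct_self_eq_zero]
    refine le_antisymm ?_ (by rw [← l2norm_sq]; positivity)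
    have h1 := hDwc D
    have e1 : ∑ j ∈ S, (ζ j - z j) * (D j - Dw j) = ∑ j ∈ S, ζ j * D j - ∑ j ∈ S, ζ j * Dw j
        - ∑ j ∈ S, z j * D j + ∑ j ∈ S, z j * Dw j := by
      rw [← Finset.sum_sub_distrib, ← Finset.sum_sub_distrib, ← Finset.sum_add_distrib]
      exact Finset.sum_congr rfl fun j _ => by ring
    have h2 := mul_nonpos_of_nonneg_of_nonpos hlam.le hmono
    rw [e1] at h2
    rw [Matrix.mulVec_sub, sub_dotProduct, dotProduct_sub, dotProduct_sub]
    simp only [signedGain] at h1 hDwDw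
    linarith
  have hgain : 1 ≤ signedGain S z w bstar := by
    have h1 : (∑ j ∈ S, |bstar j|) - offNorm S (fun j => 1 + vbar j) bstar = 1 := hbstar
    have h2 : ∑ j ∈ S, z j * bstar j = ∑ j ∈ S, |bstar j| :=
      Finset.sum_congr rfl fun j _ => sign_mul_self_eq_abs _
    have h3 : offNorm S w bstar ≤ offNorm S (fun j => 1 + vbar j) bstar := by
      refine Finset.sum_le_sum fun j _ => ?_
      rw [abs_mul, abs_mul, abs_of_nonneg (hw0 j)]
      exact mul_le_mul_of_nonneg_right ((hw1 j).2.trans (le_abs_self _)) (abs_nonneg _)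
    rw [signedGain, h2]
    linarith
  have e2 : X *ᵥ D = X *ᵥ Dw := by
    rw [Matrix.mulVec_sub] at hXD
    exact sub_eq_zero.1 hXD
  have h1 := hDwc bstar
  rw [← e2] at h1
  have h2 := dotProduct_le_l2norm_mul (X *ᵥ D) (X *ᵥ bstar)
  have e3 : l2norm (X *ᵥ (β - β₀)) = l2norm (X *ᵥ D) := by
    rw [← l2norm_neg, ← Matrix.mulVec_neg, neg_sub]
  rw [e3, mul_comm]
  nlinarith

/-! ### Gaussian tail bounds -/

section Gaussian

open scoped RealInnerProductSpace

variable {F : Type*} [NormedAddCommGroup F] [InnerProductSpace ℝ F] [FiniteDimensional ℝ F]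
  [MeasurableSpace F] [BorelSpace F]

lemma gaussianReal_abs_gt_le {σ : ℝ} (hσ : 0 ≤ σ) {l : ℝ} (hl : 0 ≤ l) :
    gaussianReal 0 (σ ^ 2).toNNReal {x | σ * l < |x|} ≤
      ENNReal.ofReal (2 * Real.exp (-l ^ 2 / 2)) := by
  have hg : HasSubgaussianMGF id (σ ^ 2).toNNReal (gaussianReal 0 (σ ^ 2).toNNReal) :=
    ⟨integrable_exp_mul_gaussianReal, fun t => by rw [mgf_id_gaussianReal]; simp⟩
  rcases hσ.eq_or_lt with rfl | hσ
  · simp [gaussianReal_zero_var]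
  have hexp : -(σ * l) ^ 2 / (2 * ((σ ^ 2).toNNReal : ℝ)) = -l ^ 2 / 2 := by
    rw [Real.coe_toNNReal _ (sq_nonneg σ)]
    field_simp
  have h1 := hg.measure_ge_le (mul_nonneg hσ.le hl)
  have h2 := hg.neg.measure_ge_le (mul_nonneg hσ.le hl)
  rw [hexp] at h1 h2
  refine (measure_mono (t := {x | σ * l ≤ id x} ∪ {x | σ * l ≤ (-id) x}) ?_).trans ?_
  · intro x hx
    exact (lt_abs.1 hx).imp (fun h => le_of_lt (b := id x) h) (fun h => le_of_lt (b := (-id) x) h)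
  refine (measure_union_le _ _).trans ?_
  rw [two_mul, ENNReal.ofReal_add (by positivity) (by positivity), ← ofReal_measureReal,
    ← ofReal_measureReal]
  exact add_le_add (ENNReal.ofReal_le_ofReal h1) (ENNReal.ofReal_le_ofReal h2)

lemma stdGaussian_abs_inner_gt_le (a : F) {l : ℝ} (hl : 0 ≤ l) :
    stdGaussian F {x | ‖a‖ * l < |⟪a, x⟫|} ≤ ENNReal.ofReal (2 * Real.exp (-l ^ 2 / 2)) := by
  have h : (stdGaussian F).map (innerSL ℝ a) = gaussianReal 0 (‖a‖ ^ 2).toNNReal := by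
    rw [IsGaussian.map_eq_gaussianReal, variance_dual_stdGaussian,
      integral_strongDual_stdGaussian, innerSL_apply_norm]
  refine le_trans (le_of_eq ?_) (gaussianReal_abs_gt_le (norm_nonneg a) hl)
  rw [← h, Measure.map_apply (by fun_prop)
    (measurableSet_lt measurable_const (by fun_prop))]
  rfl

/-- The orthogonal projection of a standard Gaussian vector is standard Gaussian. -/
lemma stdGaussian_map_orthogonalProjectionOnto (U : Submodule ℝ F) :
    (stdGaussian F).map U.orthogonalProjectionOnto = stdGaussian U := by
  apply Measure.ext_of_charFun
  ext t
  rw [charFun_stdGaussian, charFun_apply, integral_map (by fun_prop) (by fun_prop)]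
  have : ∀ x : F, ⟪U.orthogonalProjectionOnto x, t⟫ = ⟪x, (t : F)⟫ := fun x => by
    rw [Submodule.inner_orthogonalProjectionOnto_eq_of_mem_right]
  simp_rw [this]
  rw [← charFun_apply, charFun_stdGaussian]
  simp

/-- The moment generating function `(1 - 2θ)^(-1/2)` of the square of a standard Gaussian variable
at `θ = h / (2 (1 + h))` is `√(1 + h)`, hence at most `exp (h / 2)`. -/
lemma lintegral_exp_sq_gaussianReal_le {h : ℝ} (hh : 0 ≤ h) :
    ∫⁻ x, ENNReal.ofReal (Real.exp (h / (2 * (1 + h)) * x ^ 2)) ∂(gaussianReal 0 1) ≤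
      ENNReal.ofReal (Real.exp (h / 2)) := by
  have h1 : (0 : ℝ) < 1 + h := by linarith
  have hb : 0 < 1 / (2 * (1 + h)) := by positivity
  have e : ∀ x : ℝ, gaussianPDF 0 1 x * ENNReal.ofReal (Real.exp (h / (2 * (1 + h)) * x ^ 2)) =
      ENNReal.ofReal ((√(2 * Real.pi))⁻¹ * Real.exp (-(1 / (2 * (1 + h))) * x ^ 2)) := by
    intro x
    rw [gaussianPDF, ← ENNReal.ofReal_mul (gaussianPDFReal_nonneg _ _ _), gaussianPDFReal,
      mul_assoc, ← Real.exp_add]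
    simp only [NNReal.coe_one, mul_one, sub_zero]
    congr 3
    field_simp
    ring
  rw [gaussianReal_of_var_ne_zero _ one_ne_zero, lintegral_withDensity_eq_lintegral_mul₀
    (measurable_gaussianPDF _ _).aemeasurable (Measurable.aemeasurable (by fun_prop))]
  simp only [Pi.mul_apply, e]
  rw [← ofReal_integral_eq_lintegral_ofReal ((integrable_exp_neg_mul_sq hb).const_mul _)
    (Filter.Eventually.of_forall fun x => by positivity), integral_const_mul, integral_gaussian]
  refine ENNReal.ofReal_le_ofReal ?_
  have e2 : Real.pi / (1 / (2 * (1 + h))) = (2 * Real.pi) * (1 + h) := by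
    field_simp
  rw [e2, Real.sqrt_mul (by positivity : 0 ≤ 2 * Real.pi), inv_mul_cancel_left₀ (by positivity)]
  calc √(1 + h) ≤ √(Real.exp h) := Real.sqrt_le_sqrt (by linarith [Real.add_one_le_exp h])
    _ = Real.exp (h / 2) := by rw [Real.exp_half]

lemma lintegral_prod_pi {ι α : Type*} [Fintype ι] [MeasurableSpace α] (ν : Measure α)
    [IsProbabilityMeasure ν] {φ : α → ℝ≥0∞} (hφ : Measurable φ) :
    ∫⁻ x : ι → α, ∏ i, φ (x i) ∂(Measure.pi fun _ => ν) = (∫⁻ x, φ x ∂ν) ^ Fintype.card ι := by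
  rw [lintegral_prod_eq_prod_lintegral_of_indepFun Finset.univ (fun i (x : ι → α) => φ (x i))
    (iIndepFun_pi (X := fun _ : ι => φ) fun _ => hφ.aemeasurable)
    (fun i => hφ.comp (measurable_pi_apply i))]
  simp_rw [fun i : ι => (measurePreserving_eval (fun _ : ι => ν) i).lintegral_comp hφ]
  rw [Finset.prod_const, Finset.card_univ]

lemma lintegral_exp_norm_sq_stdGaussian_le {h : ℝ} (hh : 0 ≤ h) :
    ∫⁻ x, ENNReal.ofReal (Real.exp (h / (2 * (1 + h)) * ‖x‖ ^ 2)) ∂(stdGaussian F) ≤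
      ENNReal.ofReal (Real.exp (Module.finrank ℝ F * (h / 2))) := by
  rw [stdGaussian, lintegral_map (by fun_prop) (by fun_prop)]
  have e : ∀ x : Fin (Module.finrank ℝ F) → ℝ,
      ENNReal.ofReal (Real.exp (h / (2 * (1 + h)) *
        ‖∑ i, x i • stdOrthonormalBasis ℝ F i‖ ^ 2)) =
      ∏ i, ENNReal.ofReal (Real.exp (h / (2 * (1 + h)) * x i ^ 2)) := by
    intro x
    have h1 : ‖∑ i, x i • stdOrthonormalBasis ℝ F i‖ ^ 2 = ∑ i, x i ^ 2 := by
      rw [← real_inner_self_eq_norm_sq, (stdOrthonormalBasis ℝ F).orthonormal.inner_sum]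
      simp [sq]
    rw [h1, Finset.mul_sum, Real.exp_sum, ENNReal.ofReal_prod_of_nonneg fun i _ => by positivity]
  simp_rw [e]
  rw [lintegral_prod_pi (gaussianReal 0 1)
    (φ := fun x => ENNReal.ofReal (Real.exp (h / (2 * (1 + h)) * x ^ 2))) (by fun_prop),
    Real.exp_nat_mul, ENNReal.ofReal_pow (by positivity), Fintype.card_fin]
  gcongr
  exact lintegral_exp_sq_gaussianReal_le hh

/-- The `χ²` tail bound in the form `P(√s + √(2x) < ‖g‖) ≤ e⁻ˣ`, for a standard Gaussian vector
`g` in dimension at most `s`. -/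
lemma stdGaussian_norm_gt_le {s : ℕ} (hs : 0 < s) (hF : Module.finrank ℝ F ≤ s) {x : ℝ}
    (hx : 0 ≤ x) :
    stdGaussian F {y | √s + √(2 * x) < ‖y‖} ≤ ENNReal.ofReal (Real.exp (-x)) := by
  have hs' : (0 : ℝ) < √s := Real.sqrt_pos.2 (by exact_mod_cast hs)
  have hss : √(s : ℝ) ^ 2 = s := Real.sq_sqrt (by positivity)
  -- Chernoff parameter `θ = h / (2 (1 + h))`: then `θ (√s + √(2x))² - s h / 2 = s h² / 2 = x`
  set h := √(2 * x) / √s with hh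
  have hh0 : 0 ≤ h := by positivity
  have hhs : √(2 * x) = h * √s := by rw [hh, div_mul_cancel₀ _ hs'.ne']
  have hx2 : 2 * x = h ^ 2 * s := by
    rw [← Real.sq_sqrt (by positivity : 0 ≤ 2 * x), hhs, mul_pow, hss]
  set c := Real.exp (h / (2 * (1 + h)) * (√s + √(2 * x)) ^ 2) with hc
  have hsub : {y : F | √s + √(2 * x) < ‖y‖} ⊆
      {y | ENNReal.ofReal c ≤ ENNReal.ofReal (Real.exp (h / (2 * (1 + h)) * ‖y‖ ^ 2))} := by
    intro y hy
    have hy' : √s + √(2 * x) < ‖y‖ := hy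
    refine ENNReal.ofReal_le_ofReal (Real.exp_le_exp.2 ?_)
    gcongr
  refine (measure_mono hsub).trans ((meas_ge_le_lintegral_div (by fun_prop)
    (by simp [hc, Real.exp_pos]) (by simp)).trans ?_)
  refine (ENNReal.div_le_div_right (lintegral_exp_norm_sq_stdGaussian_le hh0) _).trans ?_
  rw [← ENNReal.ofReal_div_of_pos (Real.exp_pos _), ← Real.exp_sub]
  refine ENNReal.ofReal_le_ofReal (Real.exp_le_exp.2 ?_)
  have e1 : h / (2 * (1 + h)) * (√s + √(2 * x)) ^ 2 = h * (1 + h) / 2 * s := by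
    have e0 : (√s + √(2 * x)) ^ 2 = s * (1 + h) ^ 2 := by
      rw [hhs, ← hss, Real.sqrt_sq hs'.le]
      ring
    rw [e0]
    field_simp
  have e2 : (Module.finrank ℝ F : ℝ) * (h / 2) ≤ s * (h / 2) :=
    mul_le_mul_of_nonneg_right (by exact_mod_cast hF) (by positivity)
  rw [e1]
  nlinarith

lemma stdGaussian_norm_starProjection_gt_le (U : Submodule ℝ F) {s : ℕ} (hs : 0 < s)
    (hU : Module.finrank ℝ U ≤ s) {x : ℝ} (hx : 0 ≤ x) :
    stdGaussian F {y | √s + √(2 * x) < ‖U.starProjection y‖} ≤ ENNReal.ofReal (Real.exp (-x)) := by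
  have h := stdGaussian_norm_gt_le hs hU hx
  rw [← stdGaussian_map_orthogonalProjectionOnto, Measure.map_apply (by fun_prop)
    (measurableSet_lt measurable_const (by fun_prop))] at h
  exact h

end Gaussian

lemma map_toLp_eq_stdGaussian {n : ℕ} {Ω : Type*} [MeasurableSpace Ω] {μ : Measure Ω}
    [IsProbabilityMeasure μ] {ε : Fin n → Ω → ℝ}
    (hε_law : ∀ i, HasLaw (ε i) (gaussianReal 0 1) μ) (hε_indep : iIndepFun ε μ) :
    μ.map (fun ω => WithLp.toLp 2 fun i => ε i ω) = stdGaussian (EuclideanSpace ℝ (Fin n)) := by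
  have hm : ∀ i, AEMeasurable (ε i) μ := fun i => (hε_law i).aemeasurable
  rw [← map_pi_eq_stdGaussian, ← funext fun i => (hε_law i).map_eq,
    ← hε_indep.map_fun_eq_pi_map hm,
    AEMeasurable.map_map_of_aemeasurable (by fun_prop) (aemeasurable_pi_lambda _ hm)]
  rfl

/-! ### The active columns and the anti-projection -/

lemma mulVec_eq_colsIn_mulVec {n p : ℕ} (X : Matrix (Fin n) (Fin p) ℝ) (S : Finset (Fin p))
    {b : Fin p → ℝ} (hb : ∀ j ∉ S, b j = 0) :
    X *ᵥ b = colsIn X S *ᵥ fun j => b j := by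
  ext i
  simp only [Matrix.mulVec, dotProduct, colsIn, Matrix.submatrix_apply, id]
  rw [sum_eq_sum_mem_add_sum_notMem S, Finset.sum_eq_zero (s := Finset.univ)
    (fun j _ => by rw [hb j j.2, mul_zero]), add_zero]
  exact Finset.sum_subtype S (fun _ => Iff.rfl) fun j => X i j * b j

lemma compatSq_eq_of_isArgmin {n p : ℕ} {X : Matrix (Fin n) (Fin p) ℝ} {S : Finset (Fin p)}
    {w : {j // j ∉ S} → ℝ} {b : Fin p → ℝ}
    (hb : IsArgmin (fun b => l2norm (X *ᵥ b) ^ 2) (compatSet S w) b) :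
    compatSq X S w = S.card * l2norm (X *ᵥ b) ^ 2 / n := by
  refine IsLeast.csInf_eq ⟨⟨b, hb.1, rfl⟩, ?_⟩
  rintro _ ⟨c, hc, rfl⟩
  have := hb.2 c hc
  simp only at this ⊢
  gcongr

/-- A nonzero kernel vector of the Gram matrix of the active columns would make the compatibility
constant vanish. -/
lemma isUnit_det_gram_of_compatSq_pos {n p : ℕ} {X : Matrix (Fin n) (Fin p) ℝ}
    {S : Finset (Fin p)} {w : {j // j ∉ S} → ℝ} (hκ : 0 < compatSq X S w) :
    IsUnit ((colsIn X S)ᵀ * colsIn X S).det := by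
  rw [isUnit_iff_ne_zero]
  intro hdet
  obtain ⟨a, ha0, ha⟩ := Matrix.exists_mulVec_eq_zero_iff.2 hdet
  have hXa : colsIn X S *ᵥ a = 0 := by
    rw [← dotProduct_self_eq_zero, Matrix.dotProduct_mulVec, ← Matrix.mulVec_transpose,
      Matrix.mulVec_mulVec, ha, zero_dotProduct]
  set σ := ∑ j, |a j| with hσ
  have hσ0 : 0 < σ := by
    obtain ⟨j, hj⟩ := Function.ne_iff.1 ha0
    exact Finset.sum_pos' (fun j _ => abs_nonneg _) ⟨j, Finset.mem_univ _, abs_pos.2 hj⟩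
  set b : Fin p → ℝ := fun j => if h : j ∈ S then σ⁻¹ * a ⟨j, h⟩ else 0 with hb
  have hboff : ∀ j ∉ S, b j = 0 := fun j hj => by simp [hb, hj]
  have hbin : (fun j : {j // j ∈ S} => b j) = σ⁻¹ • a := by
    ext j; simp [hb, j.2]
  have hXb : X *ᵥ b = 0 := by
    rw [mulVec_eq_colsIn_mulVec X S hboff, hbin, Matrix.mulVec_smul, hXa, smul_zero]
  have hmem : b ∈ compatSet S w := by
    have h1 : offNorm S w b = 0 := Finset.sum_eq_zero fun j _ => by
      rw [hboff j j.2, mul_zero, abs_zero]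
    have h2 : ∑ j ∈ S, |b j| = 1 := by
      rw [Finset.sum_subtype S (fun _ => Iff.rfl) fun j => |b j|]
      have h3 : ∀ j : {j // j ∈ S}, |b j| = σ⁻¹ * |a j| := fun j => by
        rw [show b j = σ⁻¹ * a j from congrFun hbin j, abs_mul, abs_of_pos (inv_pos.2 hσ0)]
      simp_rw [h3]
      rw [← Finset.mul_sum, inv_mul_cancel₀ hσ0.ne']
    change _ - _ = (1 : ℝ)
    rw [h1, h2, sub_zero]
  have hle : compatSq X S w ≤ S.card * l2norm (X *ᵥ b) ^ 2 / n := by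
    refine csInf_le ⟨0, ?_⟩ ⟨b, hmem, rfl⟩
    rintro _ ⟨c, -, rfl⟩
    positivity
  rw [hXb] at hle
  simp [l2norm] at hle
  linarith

lemma antiProj_transpose_mul_colsIn {n p : ℕ} {X : Matrix (Fin n) (Fin p) ℝ}
    {S : Finset (Fin p)} (h : IsUnit ((colsIn X S)ᵀ * colsIn X S).det) :
    (antiProj X S)ᵀ * colsIn X S = 0 := by
  have h1 : (colsIn X S)ᵀ * antiProj X S = 0 := by
    rw [antiProj, Matrix.mul_sub, gramInv, ← Matrix.mul_assoc, ← Matrix.mul_assoc,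
      ← Matrix.mul_assoc, Matrix.mul_nonsing_inv _ h, Matrix.one_mul, sub_self]
  rw [← Matrix.transpose_inj, Matrix.transpose_mul, Matrix.transpose_transpose, h1,
    Matrix.transpose_zero]

/-- Off the active set, noise orthogonal to the active columns only sees the anti-projection. -/
lemma antiProj_transpose_mulVec {n p : ℕ} {X : Matrix (Fin n) (Fin p) ℝ} {S : Finset (Fin p)}
    {r : Fin n → ℝ} (hr : (colsIn X S)ᵀ *ᵥ r = 0) :
    (antiProj X S)ᵀ *ᵥ r = (colsOut X S)ᵀ *ᵥ r := by
  rw [antiProj, Matrix.transpose_sub, Matrix.sub_mulVec, Matrix.mul_assoc, Matrix.mul_assoc,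
    Matrix.transpose_mul, ← Matrix.mulVec_mulVec, hr, Matrix.mulVec_zero, sub_zero]

/-- The span of the columns of `X` with index in `S`, in Euclidean space. -/
noncomputable def activeSpan {n p : ℕ} (X : Matrix (Fin n) (Fin p) ℝ) (S : Finset (Fin p)) :
    Submodule ℝ (EuclideanSpace ℝ (Fin n)) :=
  LinearMap.range
    ((WithLp.linearEquiv 2 ℝ (Fin n → ℝ)).symm.toLinearMap ∘ₗ (colsIn X S).mulVecLin)

lemma finrank_activeSpan_le {n p : ℕ} (X : Matrix (Fin n) (Fin p) ℝ) (S : Finset (Fin p)) :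
    Module.finrank ℝ (activeSpan X S) ≤ S.card :=
  (LinearMap.finrank_range_le _).trans (by simp)

/-- The columns of the anti-projection, as vectors of Euclidean space. -/
noncomputable def antiProjCol {n p : ℕ} (X : Matrix (Fin n) (Fin p) ℝ) (S : Finset (Fin p))
    (j : {j // j ∉ S}) : EuclideanSpace ℝ (Fin n) :=
  WithLp.toLp 2 fun i => antiProj X S i j

lemma norm_antiProjCol {n p : ℕ} (X : Matrix (Fin n) (Fin p) ℝ) (S : Finset (Fin p))
    (j : {j // j ∉ S}) : ‖antiProjCol X S j‖ = antiProjScale X S j := by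
  rw [antiProjScale, EuclideanSpace.norm_eq]
  simp [antiProjCol, Matrix.mul_apply, sq]

lemma colsIn_transpose_mulVec_sub_starProjection {n p : ℕ} (X : Matrix (Fin n) (Fin p) ℝ)
    (S : Finset (Fin p)) (y : EuclideanSpace ℝ (Fin n)) :
    (colsIn X S)ᵀ *ᵥ (WithLp.ofLp (y - (activeSpan X S).starProjection y)) = 0 := by
  have h : ∀ c : {j // j ∈ S} → ℝ,
      ((colsIn X S)ᵀ *ᵥ (WithLp.ofLp (y - (activeSpan X S).starProjection y))) ⬝ᵥ c = 0 := by
    intro c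
    have h1 := (Submodule.mem_orthogonal (activeSpan X S) _).1
      (Submodule.sub_starProjection_mem_orthogonal (K := activeSpan X S) y)
      (WithLp.toLp 2 (colsIn X S *ᵥ c)) ⟨c, rfl⟩
    rw [EuclideanSpace.inner_eq_star_dotProduct] at h1
    rw [Matrix.mulVec_transpose, ← Matrix.dotProduct_mulVec]
    simpa using h1
  exact dotProduct_eq_zero _ h

/-- The correlation of an inactive column with the part of the noise orthogonal to the active
columns. -/
lemma transpose_mulVec_sub_starProjection {n p : ℕ} {X : Matrix (Fin n) (Fin p) ℝ}
    {S : Finset (Fin p)} (h : IsUnit ((colsIn X S)ᵀ * colsIn X S).det)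
    (y : EuclideanSpace ℝ (Fin n)) (j : {j // j ∉ S}) :
    (Xᵀ *ᵥ (WithLp.ofLp (y - (activeSpan X S).starProjection y))) j =
      inner ℝ (antiProjCol X S j) y := by
  have h1 := congrFun (antiProj_transpose_mulVec
    (colsIn_transpose_mulVec_sub_starProjection X S y)) j
  obtain ⟨c, hc⟩ := Submodule.starProjection_apply_mem (activeSpan X S) y
  have hc' : WithLp.ofLp ((activeSpan X S).starProjection y) = colsIn X S *ᵥ c := by
    rw [← hc]; rfl
  have h2 : (colsOut X S)ᵀ *ᵥ (WithLp.ofLp (y - (activeSpan X S).starProjection y)) =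
      fun j : {j // j ∉ S} =>
        (Xᵀ *ᵥ (WithLp.ofLp (y - (activeSpan X S).starProjection y))) j := rfl
  rw [h2] at h1
  simp only at h1
  rw [← h1, WithLp.ofLp_sub, Matrix.mulVec_sub, hc', Matrix.mulVec_mulVec,
    antiProj_transpose_mul_colsIn h, Matrix.zero_mulVec, sub_zero,
    EuclideanSpace.inner_eq_star_dotProduct, dotProduct_comm]
  rfl

/-! ### The exceptional event -/

lemma noiseLevel_nonneg (p : ℕ) (t : ℝ) : 0 ≤ noiseLevel p t := Real.sqrt_nonneg _

lemma two_mul_exp_neg_noiseLevel_sq {p : ℕ} (hp : 0 < p) {t : ℝ} (ht : 0 ≤ t) :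
    2 * Real.exp (-noiseLevel p t ^ 2 / 2) = Real.exp (-t) / p := by
  have hp1 : (1 : ℝ) ≤ p := by exact_mod_cast hp
  have h2p : (0 : ℝ) < 2 * p := by linarith
  have hlog : 0 ≤ Real.log (2 * p) := Real.log_nonneg (by linarith)
  rw [noiseLevel, Real.sq_sqrt (by linarith),
    show -(2 * (Real.log (2 * p) + t)) / 2 = -Real.log (2 * p) + -t by ring, Real.exp_add,
    Real.exp_neg, Real.exp_log h2p]
  field_simp

/-- The noise vectors for which an inactive column is too correlated with the anti-projected noise,
or the projection onto the active columns is too long. -/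
def exceptionalSet {n p : ℕ} (X : Matrix (Fin n) (Fin p) ℝ) (S : Finset (Fin p)) (t x : ℝ) :
    Set (EuclideanSpace ℝ (Fin n)) :=
  (⋃ j, {y | antiProjScale X S j * noiseLevel p t < |inner ℝ (antiProjCol X S j) y|}) ∪
    {y | √S.card + √(2 * x) < ‖(activeSpan X S).starProjection y‖}

lemma stdGaussian_exceptionalSet_le {n p : ℕ} (X : Matrix (Fin n) (Fin p) ℝ)
    {S : Finset (Fin p)} (hS : S.Nonempty) {t x : ℝ} (ht : 0 ≤ t) (hx : 0 ≤ x) :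
    stdGaussian (EuclideanSpace ℝ (Fin n)) (exceptionalSet X S t x) ≤
      ENNReal.ofReal (Real.exp (-t) + Real.exp (-x)) := by
  have hp : 0 < p := (Nat.zero_le _).trans_lt hS.choose.isLt
  have hp' : (0 : ℝ) < p := by exact_mod_cast hp
  rw [ENNReal.ofReal_add (Real.exp_pos _).le (Real.exp_pos _).le]
  refine (measure_union_le _ _).trans (add_le_add ?_ ?_)
  · refine (measure_iUnion_fintype_le _ _).trans ?_
    calc _ ≤ ∑ _j : {j // j ∉ S}, ENNReal.ofReal (Real.exp (-t) / p) := by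
          refine Finset.sum_le_sum fun j _ => ?_
          rw [← norm_antiProjCol, ← two_mul_exp_neg_noiseLevel_sq hp ht]
          exact stdGaussian_abs_inner_gt_le _ (noiseLevel_nonneg p t)
      _ ≤ p * ENNReal.ofReal (Real.exp (-t) / p) := by
          rw [Finset.sum_const, nsmul_eq_mul]
          gcongr
          exact (Fintype.card_subtype_le _).trans (by simp)
      _ = ENNReal.ofReal (Real.exp (-t)) := by
          rw [← ENNReal.ofReal_natCast, ← ENNReal.ofReal_mul (Nat.cast_nonneg p),
            mul_div_cancel₀ _ hp'.ne']
  · exact stdGaussian_norm_starProjection_gt_le _ hS.card_pos (finrank_activeSpan_le X S) hx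

/-! ### The lower bound -/

/-- The real form of the betamin condition: a finite supremum forces nonzero predictions. -/
lemma pos_and_lt_of_boldB_lt {n p : ℕ} {X : Matrix (Fin n) (Fin p) ℝ} {S : Finset (Fin p)}
    {vbar : {j // j ∉ S} → ℝ} {b : ({j // j ∉ S} → ℝ) → Fin p → ℝ} {β₀ z : Fin p → ℝ} {lam : ℝ}
    (hlam : 0 < lam)
    (hbeta : ∀ j ∈ S, ENNReal.ofReal lam * boldB X vbar b j < ENNReal.ofReal |β₀ j|)
    {w : {j // j ∉ S} → ℝ} (hw : w ∈ weights S vbar) (hb : b w ∈ signedSet S z w) :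
    0 < l2norm (X *ᵥ b w) ^ 2 ∧
      ∀ j ∈ S, lam * |b w j| / l2norm (X *ᵥ b w) ^ 2 < |β₀ j| := by
  have hlt : ∀ j ∈ S, ENNReal.ofReal lam *
      (ENNReal.ofReal |b w j| / ENNReal.ofReal (l2norm (X *ᵥ b w) ^ 2)) <
        ENNReal.ofReal |β₀ j| := fun j hj => by
    refine lt_of_le_of_lt ?_ (hbeta j hj)
    gcongr
    exact le_iSup₂ (f := fun (w : {j // j ∉ S} → ℝ) (_ : w ∈ weights S vbar) =>
      ENNReal.ofReal |b w j| / ENNReal.ofReal (l2norm (X *ᵥ b w) ^ 2)) w hw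
  have hpos : 0 < l2norm (X *ᵥ b w) ^ 2 := by
    refine (sq_nonneg _).lt_of_ne fun h0 => ?_
    have hz : ∀ j ∈ S, b w j = 0 := fun j hj => by
      by_contra hne
      have h1 := hlt j hj
      have h2 : ENNReal.ofReal |b w j| ≠ 0 := by simpa using hne
      have h3 : ENNReal.ofReal lam ≠ 0 := by simpa using hlam
      rw [← h0, ENNReal.ofReal_zero, ENNReal.div_zero h2, ENNReal.mul_top h3] at h1
      exact not_top_lt h1
    have h1 : 1 ≤ (∑ j ∈ S, z j * b w j) - offNorm S w (b w) := hb
    rw [Finset.sum_eq_zero fun j hj => by rw [hz j hj, mul_zero]] at h1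
    have h2 : 0 ≤ offNorm S w (b w) := Finset.sum_nonneg fun j _ => abs_nonneg _
    linarith
  refine ⟨hpos, fun j hj => ?_⟩
  have h1 := hlt j hj
  rw [← ENNReal.ofReal_div_of_pos hpos, ← ENNReal.ofReal_mul hlam.le] at h1
  rw [mul_div_assoc]
  exact lt_of_not_ge fun h => (ENNReal.ofReal_le_ofReal h).not_gt h1

end LassoLower

theorem mainTheorem3
    {n p : ℕ} (X : Matrix (Fin n) (Fin p) ℝ) (β₀ : Fin p → ℝ)
    (S₀ : Finset (Fin p)) (hS₀ : S₀ = LassoLower.activeSet β₀)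
    -- i.i.d. standard Gaussian noise
    {Ω : Type*} [MeasurableSpace Ω] (μ : Measure Ω) [IsProbabilityMeasure μ]
    (ε : Fin n → Ω → ℝ) (hε_law : ∀ i, HasLaw (ε i) (gaussianReal 0 1) μ)
    (hε_indep : iIndepFun ε μ)
    -- the tuning parameter
    (t lam : ℝ) (ht : 0 < t)
    (hlam : ‖LassoLower.antiProjScale X S₀‖ * LassoLower.noiseLevel p t < lam)
    -- the compatibility constant with weights `1 + v̄`
    (hκ : 0 < LassoLower.compatSq X S₀ (fun j => 1 + LassoLower.vBar X S₀ lam t j))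
    -- any choice of the minimizer `b*(v̄)`
    (bstar : Fin p → ℝ)
    (hbstar : LassoLower.IsArgmin (fun b => LassoLower.l2norm (X *ᵥ b) ^ 2)
      (LassoLower.compatSet S₀ (fun j => 1 + LassoLower.vBar X S₀ lam t j)) bstar)
    -- any choice of the minimizers `b(w)`, with `z* = sign b*(v̄)`
    (b : ({j // j ∉ S₀} → ℝ) → Fin p → ℝ)
    (hb : ∀ w ∈ LassoLower.weights S₀ (LassoLower.vBar X S₀ lam t),
      LassoLower.IsArgmin (fun c => LassoLower.l2norm (X *ᵥ c) ^ 2)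
        (LassoLower.signedSet S₀ (fun j => Real.sign (bstar j)) w) (b w))
    -- `u_j` is the diagonal entry of `(X_{S₀}ᵀ X_{S₀})⁻¹` or its square root; either is allowed
    (u : {j // j ∈ S₀} → ℝ)
    (hu : (∀ j, u j = LassoLower.gramInv X S₀ j j) ∨
      (∀ j, u j = √(LassoLower.gramInv X S₀ j j)))
    -- the betamin condition
    (hbeta : ∀ j : {j // j ∈ S₀},
      ENNReal.ofReal lam * (LassoLower.boldB X (LassoLower.vBar X S₀ lam t) b j +
          ENNReal.ofReal (u j * LassoLower.noiseLevel p t / lam)) < ENNReal.ofReal |β₀ j| ∧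
        Real.sign (β₀ j) = Real.sign (bstar j))
    (x : ℝ) (hx : 0 < x) :
    ∃ E : Set Ω, MeasurableSet E ∧
      1 - Real.exp (-t) - Real.exp (-x) ≤ μ.real E ∧
      ∀ ω ∈ E, ∃ βhat : Fin p → ℝ,
        LassoLower.IsLassoKKT X (X *ᵥ β₀ + fun i => ε i ω) lam βhat ∧
        √(S₀.card / LassoLower.compatSq X S₀ (fun j => 1 + LassoLower.vBar X S₀ lam t j)) *
            √(lam ^ 2 / n) - √(S₀.card) - √(2 * x) ≤
          LassoLower.l2norm (X *ᵥ (βhat - β₀)) := by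
  have hnv : 0 ≤ ‖LassoLower.antiProjScale X S₀‖ * LassoLower.noiseLevel p t :=
    mul_nonneg (norm_nonneg _) (LassoLower.noiseLevel_nonneg p t)
  have hlam0 : 0 < lam := hnv.trans_lt hlam
  have hv1 : ∀ j, LassoLower.vBar X S₀ lam t j < 1 := fun j => by
    rw [LassoLower.vBar, div_lt_one hlam0]
    refine lt_of_le_of_lt ?_ hlam
    exact mul_le_mul_of_nonneg_right
      ((le_abs_self _).trans (norm_le_pi_norm (LassoLower.antiProjScale X S₀) j))
      (LassoLower.noiseLevel_nonneg p t)
  have hκeq := LassoLower.compatSq_eq_of_isArgmin hbstar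
  have hS₀ne : S₀.Nonempty := by
    rw [Finset.nonempty_iff_ne_empty]
    intro h0
    rw [hκeq, h0] at hκ
    simp at hκ
  have hunit := LassoLower.isUnit_det_gram_of_compatSq_pos hκ
  have hβ₀off : ∀ j ∉ S₀, β₀ j = 0 := fun j hj => by
    simpa [hS₀, LassoLower.activeSet] using hj
  have hreal : ∀ w ∈ LassoLower.weights S₀ (LassoLower.vBar X S₀ lam t), _ := fun w hw =>
    LassoLower.pos_and_lt_of_boldB_lt (β₀ := β₀) hlam0
      (fun j hj => lt_of_le_of_lt (mul_le_mul_right le_self_add _) (hbeta ⟨j, hj⟩).1) hw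
      (hb w hw).1
  set ξ : Ω → EuclideanSpace ℝ (Fin n) := fun ω => WithLp.toLp 2 fun i => ε i ω with hξ
  have hξm : AEMeasurable ξ μ := by
    have : AEMeasurable (fun ω i => ε i ω) μ :=
      aemeasurable_pi_lambda _ fun i => (hε_law i).aemeasurable
    fun_prop
  set B := LassoLower.exceptionalSet X S₀ t x with hB
  have hμB : μ (ξ ⁻¹' B) ≤ ENNReal.ofReal (Real.exp (-t) + Real.exp (-x)) := by
    refine (Measure.le_map_apply hξm B).trans ?_
    rw [hξ, LassoLower.map_toLp_eq_stdGaussian hε_law hε_indep]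
    exact LassoLower.stdGaussian_exceptionalSet_le X hS₀ne ht.le hx.le
  -- the noise is only almost everywhere measurable, hence the measurable hull
  refine ⟨(toMeasurable μ (ξ ⁻¹' B))ᶜ, (measurableSet_toMeasurable _ _).compl, ?_, ?_⟩
  · rw [probReal_compl_eq_one_sub (measurableSet_toMeasurable _ _), measureReal_def,
      measure_toMeasurable]
    have h1 := ENNReal.toReal_mono ENNReal.ofReal_ne_top hμB
    rw [ENNReal.toReal_ofReal (by positivity)] at h1
    linarith
  intro ω hω
  have hω' : ξ ω ∉ B := fun h => hω (subset_toMeasurable _ _ h)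
  simp only [hB, LassoLower.exceptionalSet, Set.mem_union, Set.mem_iUnion, Set.mem_ofPred_eq,
    not_or, not_exists, not_lt] at hω'
  obtain ⟨hω1, hω2⟩ := hω'
  -- compare with the Lasso whose noise lacks its component `π` along the active columns
  set y := ξ ω with hy
  set π := (LassoLower.activeSpan X S₀).starProjection y with hπ
  obtain ⟨βhat, hβhat⟩ := LassoLower.exists_isLassoKKT X (X *ᵥ β₀ + fun i => ε i ω) hlam0
  obtain ⟨β', hβ'⟩ := LassoLower.exists_isLassoKKT X (X *ᵥ β₀ + WithLp.ofLp (y - π)) hlam0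
  refine ⟨βhat, hβhat, ?_⟩
  have hmain := hβ'.le_of_orthogonal_noise hβ₀off hlam0 hv1 hbstar.1 hb
    (fun w hw => (hreal w hw).1) (fun w hw => (hreal w hw).2)
    (fun j hj => (hbeta ⟨j, hj⟩).2)
    (fun j hj => congrFun
      (LassoLower.colsIn_transpose_mulVec_sub_starProjection X S₀ y) ⟨j, hj⟩)
    (fun j => by
      rw [LassoLower.transpose_mulVec_sub_starProjection hunit, LassoLower.vBar,
        mul_div_cancel₀ _ hlam0.ne']
      exact hω1 j)
  have hdiff : LassoLower.l2norm (X *ᵥ (β' - βhat)) ≤ √S₀.card + √(2 * x) := by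
    refine le_trans ?_ hω2
    rw [← neg_sub, Matrix.mulVec_neg, LassoLower.l2norm_neg]
    refine (hβhat.l2norm_sub_le hlam0.le hβ').trans (le_of_eq ?_)
    rw [LassoLower.l2norm]
    congr 1
    ext i
    simp [hy, hξ]
  have htri : LassoLower.l2norm (X *ᵥ (β' - β₀)) ≤
      LassoLower.l2norm (X *ᵥ (β' - βhat)) + LassoLower.l2norm (X *ᵥ (βhat - β₀)) := by
    refine le_trans (le_of_eq ?_) (LassoLower.l2norm_add_le _ _)
    rw [← Matrix.mulVec_add, sub_add_sub_cancel]
  have hs : (0 : ℝ) < S₀.card := by exact_mod_cast hS₀ne.card_pos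
  have hn : (0 : ℝ) < n := by
    refine (Nat.cast_nonneg n).lt_of_ne fun h0 => ?_
    rw [hκeq, ← h0, div_zero] at hκ
    exact lt_irrefl _ hκ
  have hX0 : 0 < LassoLower.l2norm (X *ᵥ bstar) := by
    refine (LassoLower.l2norm_nonneg _).lt_of_ne fun h0 => ?_
    rw [hκeq, ← h0] at hκ
    simp at hκ
  have hvalue : √(S₀.card / LassoLower.compatSq X S₀
      (fun j => 1 + LassoLower.vBar X S₀ lam t j)) * √(lam ^ 2 / n) =
        lam / LassoLower.l2norm (X *ᵥ bstar) := by
    rw [← Real.sqrt_mul (div_nonneg hs.le hκ.le), hκeq,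
      ← Real.sqrt_sq (div_pos hlam0 hX0).le]
    congr 1
    field_simp
  have hlow : lam / LassoLower.l2norm (X *ᵥ bstar) ≤ LassoLower.l2norm (X *ᵥ (β' - β₀)) := by
    rw [div_le_iff₀ hX0, mul_comm]
    exact hmain
  rw [hvalue]
  linarith
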